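/- Let $\Bbbk$ be a field, let $B$ and $A$ be bialgebras over $\Bbbk$ and let $C$ be a coalgebra over $\Bbbk$. A covering of $A$ by $B$ indexed by $C$ is a surjective coalgebra map $f\colon B\otimes C\to A$ (where $B\otimes C$ has the tensor product coalgebra structure) that is a measuring, i.e. such that for all $b,b'\in B$ and $c\in C$ $$f(bb'\otimes c)=\sum_{(c)} f(b\otimes c_1)\,f(b'\otimes c_2),\qquad f(1\otimes c)=\varepsilon(c)1_A .$$ The coradical of a coalgebra is the sum of its simple subcoalgebras. Theorem. Let $f\colon B\otimes C\to A$ be a covering of bialgebras. If $B$ is a Hopf algebra whose coradical is cocommutative, then $A$ is a Hopf algebra, i.e. the bialgebra $A$ has an antipode. -/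

import Mathlib

open scoped TensorProduct

namespace BialgCovering

section Coradical

variable (k : Type*) {C : Type*} [Field k] [AddCommGroup C] [Module k C] [Coalgebra k C]

/-- A subspace `W` of a coalgebra `C` is a subcoalgebra if `Δ(W) ⊆ W ⊗ W`, where `W ⊗ W` is
regarded as a subspace of `C ⊗ C`. -/
def IsSubcoalgebra (W : Submodule k C) : Prop :=
  ∀ x ∈ W, Coalgebra.comul (R := k) x ∈ LinearMap.range (TensorProduct.mapIncl W W)

/-- A subcoalgebra is simple if it is nonzero and its only subcoalgebras are zero and itself. -/
structure IsSimpleSubcoalgebra (W : Submodule k C) : Prop where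
  isSubcoalgebra : IsSubcoalgebra k W
  ne_bot : W ≠ ⊥
  eq_bot_or_eq : ∀ V : Submodule k C, IsSubcoalgebra k V → V ≤ W → V = ⊥ ∨ V = W

variable (C) in
/-- The coradical of a coalgebra: the sum of all its simple subcoalgebras. -/
def coradical : Submodule k C :=
  sSup {W | IsSimpleSubcoalgebra k W}

variable (C) in
/-- The coradical of `C` is cocommutative: the comultiplication of each of its elements is fixed
by the flip of `C ⊗ C`. -/
def HasCocommCoradical : Prop :=
  ∀ x ∈ coradical k C,
    TensorProduct.comm k C C (Coalgebra.comul (R := k) x) = Coalgebra.comul (R := k) x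

end Coradical

section Covering

variable {k B C A : Type*} [Field k]

/-- A linear map `f : B ⊗ C → A`, with `B`, `A` algebras and `C` a coalgebra, is a measuring if
`f(bb' ⊗ c) = ∑ f(b ⊗ c₁) f(b' ⊗ c₂)` and `f(1 ⊗ c) = ε(c) 1`. -/
structure IsMeasuring [Ring B] [Algebra k B] [AddCommGroup C] [Module k C] [Coalgebra k C]
    [Ring A] [Algebra k A] (f : B ⊗[k] C →ₗ[k] A) : Prop where
  map_mul_tmul : ∀ (b b' : B) (c : C),
    f ((b * b') ⊗ₜ[k] c) =
      LinearMap.mul' k A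
        (TensorProduct.map (TensorProduct.curry f b) (TensorProduct.curry f b')
          (Coalgebra.comul (R := k) c))
  map_one_tmul : ∀ c : C,
    f ((1 : B) ⊗ₜ[k] c) = algebraMap k A (Coalgebra.counit (R := k) c)

/-- A covering of the bialgebra `A` by the bialgebra `B`, indexed by the coalgebra `C`: a coalgebra
map `f : B ⊗ C → A` (for the tensor product coalgebra structure) that is a measuring and is
surjective. -/
structure IsCovering [Ring B] [Bialgebra k B] [AddCommGroup C] [Module k C] [Coalgebra k C]
    [Ring A] [Bialgebra k A] (f : B ⊗[k] C →ₗc[k] A) : Prop where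
  isMeasuring : IsMeasuring (f : B ⊗[k] C →ₗ[k] A)
  surjective : Function.Surjective f

end Covering

end BialgCovering

/-! The measuring property makes f convolution invertible in Hom(B ⊗ C, A), with inverse g = f ∘ (S
⊗ id). If g vanishes on ker f, it factors as S' ∘ f, and surjectivity of f makes S' an antipode of
A. So everything rests on g(ker f) = 0 (`map_antipode_eq_zero`). By local finiteness, B and C may be
replaced by finite-dimensional subcoalgebras D and E. If f has on D ⊗ E a right inverse of the form
σ ∘ f, uniqueness of inverses gives g = σ ∘ f there, and g kills the kernel.

To build σ, let D₀ be the coradical of D. It is cocommutative, so S is a coalgebra map on it, and f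
and g restrict to mutually inverse coalgebra maps on D₀ ⊗ E. Inverses of coalgebra maps reverse the
comultiplication, so the image P of f is cocommutative. Thus P* is a commutative subalgebra of (D₀ ⊗
E)*, and f corresponds to an element of P* ⊗ A that is right invertible in (D₀ ⊗ E)* ⊗ A. A Nakayama
argument (`exists_right_inv_of_injective`) finds a right inverse already in P* ⊗ A, that is, a map τ
on A with id * τ = 1 on P.

Pulled back to D ⊗ E, the map 1 - id * τ vanishes on D₀ ⊗ E. It is therefore nilpotent, because the
annihilator of D₀ in D* is nilpotent (`isNilpotent_perp_coradical`), and a geometric series corrects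
τ to σ. -/

namespace BialgCovering

/-! ### Slicing tensors by functionals -/

section Contraction

variable {k C D : Type*} [Field k] [AddCommGroup C] [Module k C] [AddCommGroup D] [Module k D]

/-- Functionals on the right factor separate the elements of a tensor product. -/
lemma eq_zero_of_lTensor_eq_zero (t : C ⊗[k] D)
    (h : ∀ χ : D →ₗ[k] k, TensorProduct.rid k C (LinearMap.lTensor C χ t) = 0) : t = 0 := by
  let b := Module.Free.chooseBasis k D
  apply (TensorProduct.equivFinsuppOfBasisRight (M := C) b).injective
  rw [map_zero]
  ext i
  rw [TensorProduct.equivFinsuppOfBasisRight_apply]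
  exact h (b.coord i)

/-- Functionals on the left factor separate the elements of a tensor product. -/
lemma eq_zero_of_rTensor_eq_zero (t : C ⊗[k] D)
    (h : ∀ χ : C →ₗ[k] k, TensorProduct.lid k D (LinearMap.rTensor D χ t) = 0) : t = 0 := by
  let b := Module.Free.chooseBasis k C
  apply (TensorProduct.equivFinsuppOfBasisLeft (N := D) b).injective
  rw [map_zero]
  ext i
  rw [TensorProduct.equivFinsuppOfBasisLeft_apply]
  exact h (b.coord i)

/-- W ⊗ W is the intersection of W ⊗ C and C ⊗ W, and a projection onto W detects each of them
through contractions. -/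
lemma mem_range_mapIncl_iff (W : Submodule k C) (t : C ⊗[k] C) :
    t ∈ LinearMap.range (TensorProduct.mapIncl W W) ↔
      (∀ χ : C →ₗ[k] k, TensorProduct.rid k C (LinearMap.lTensor C χ t) ∈ W) ∧
      ∀ χ : C →ₗ[k] k, TensorProduct.lid k C (LinearMap.rTensor C χ t) ∈ W := by
  constructor
  · rintro ⟨s, rfl⟩
    induction s using TensorProduct.induction_on with
    | zero => simp
    | add s t hs ht =>
      simp only [map_add]
      exact ⟨fun χ => add_mem (hs.1 χ) (ht.1 χ), fun χ => add_mem (hs.2 χ) (ht.2 χ)⟩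
    | tmul x y =>
      simp only [TensorProduct.mapIncl, TensorProduct.map_tmul, LinearMap.lTensor_tmul,
        LinearMap.rTensor_tmul, TensorProduct.rid_tmul, TensorProduct.lid_tmul]
      exact ⟨fun χ => W.smul_mem _ x.2, fun χ => W.smul_mem _ y.2⟩
  · rintro ⟨hr, hl⟩
    obtain ⟨p, hp⟩ := LinearMap.exists_leftInverse_of_injective W.subtype W.ker_subtype
    have hpW : ∀ w ∈ W, (W.subtype ∘ₗ p) w = w := fun w hw => by
      have := LinearMap.congr_fun hp ⟨w, hw⟩
      simpa using congrArg Subtype.val this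
    have h1 : LinearMap.rTensor C (W.subtype ∘ₗ p) t = t := by
      rw [← sub_eq_zero]
      refine eq_zero_of_lTensor_eq_zero _ fun χ => ?_
      have : ∀ s : C ⊗[k] C, TensorProduct.rid k C (LinearMap.lTensor C χ
          (LinearMap.rTensor C (W.subtype ∘ₗ p) s)) =
          (W.subtype ∘ₗ p) (TensorProduct.rid k C (LinearMap.lTensor C χ s)) := fun s => by
        induction s using TensorProduct.induction_on with
        | zero => simp
        | add s t hs ht => simp only [map_add, hs, ht]
        | tmul x y => simp
      rw [map_sub, map_sub, this, hpW _ (hr χ), sub_self]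
    have h2 : LinearMap.lTensor C (W.subtype ∘ₗ p) t = t := by
      rw [← sub_eq_zero]
      refine eq_zero_of_rTensor_eq_zero _ fun χ => ?_
      have : ∀ s : C ⊗[k] C, TensorProduct.lid k C (LinearMap.rTensor C χ
          (LinearMap.lTensor C (W.subtype ∘ₗ p) s)) =
          (W.subtype ∘ₗ p) (TensorProduct.lid k C (LinearMap.rTensor C χ s)) := fun s => by
        induction s using TensorProduct.induction_on with
        | zero => simp
        | add s t hs ht => simp only [map_add, hs, ht]
        | tmul x y => simp
      rw [map_sub, map_sub, this, hpW _ (hl χ), sub_self]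
    refine ⟨TensorProduct.map p p t, ?_⟩
    have : ∀ s : C ⊗[k] C, TensorProduct.mapIncl W W (TensorProduct.map p p s) =
        LinearMap.rTensor C (W.subtype ∘ₗ p) (LinearMap.lTensor C (W.subtype ∘ₗ p) s) := fun s => by
      induction s using TensorProduct.induction_on with
      | zero => simp
      | add s t hs ht => simp only [map_add, hs, ht]
      | tmul x y => simp [TensorProduct.mapIncl]
    rw [this, h2, h1]

end Contraction

/-! ### Actions of the dual and local finiteness -/

section Actions

variable {k C : Type*} [Field k] [AddCommGroup C] [Module k C] [Coalgebra k C]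

/-- The left action of the dual on a coalgebra, `χ ⇀ c = ∑ c₁ χ(c₂)`. -/
noncomputable def leftAct (χ : C →ₗ[k] k) : C →ₗ[k] C :=
  (TensorProduct.rid k C).toLinearMap ∘ₗ LinearMap.lTensor C χ ∘ₗ Coalgebra.comul

/-- The right action of the dual on a coalgebra, `c ↼ χ = ∑ χ(c₁) c₂`. -/
noncomputable def rightAct (χ : C →ₗ[k] k) : C →ₗ[k] C :=
  (TensorProduct.lid k C).toLinearMap ∘ₗ LinearMap.rTensor C χ ∘ₗ Coalgebra.comul

lemma leftAct_apply (χ : C →ₗ[k] k) (c : C) :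
    leftAct χ c = TensorProduct.rid k C (LinearMap.lTensor C χ (Coalgebra.comul c)) := rfl

lemma rightAct_apply (χ : C →ₗ[k] k) (c : C) :
    rightAct χ c = TensorProduct.lid k C (LinearMap.rTensor C χ (Coalgebra.comul c)) := rfl

/-- Subcoalgebras are the sub-bimodules over the dual, which makes sums and generation formal. -/
lemma isSubcoalgebra_iff (W : Submodule k C) :
    IsSubcoalgebra k W ↔ (∀ χ : C →ₗ[k] k, ∀ x ∈ W, leftAct χ x ∈ W) ∧
      ∀ χ : C →ₗ[k] k, ∀ x ∈ W, rightAct χ x ∈ W := by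
  simp only [IsSubcoalgebra, mem_range_mapIncl_iff, leftAct_apply, rightAct_apply]
  exact ⟨fun h => ⟨fun χ x hx => (h x hx).1 χ, fun χ x hx => (h x hx).2 χ⟩,
    fun h x hx => ⟨fun χ => h.1 χ x hx, fun χ => h.2 χ x hx⟩⟩

lemma comul_leftAct (χ : C →ₗ[k] k) (c : C) :
    Coalgebra.comul (R := k) (leftAct χ c) =
      LinearMap.lTensor C (leftAct χ) (Coalgebra.comul c) := by
  have h1 : ∀ t : C ⊗[k] C, Coalgebra.comul (R := k) (TensorProduct.rid k C
      (LinearMap.lTensor C χ t)) = LinearMap.lTensor C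
        ((TensorProduct.rid k C).toLinearMap ∘ₗ LinearMap.lTensor C χ)
          (TensorProduct.assoc k C C C (LinearMap.rTensor C Coalgebra.comul t)) := fun t => by
    induction t using TensorProduct.induction_on with
    | zero => simp
    | add s t hs ht => simp only [map_add, hs, ht]
    | tmul x y =>
      simp only [LinearMap.lTensor_tmul, TensorProduct.rid_tmul, map_smul, LinearMap.rTensor_tmul]
      generalize Coalgebra.comul (R := k) x = s
      induction s using TensorProduct.induction_on with
      | zero => simp
      | add s t hs ht => simp only [map_add, TensorProduct.add_tmul, hs, ht, smul_add]
      | tmul x z => simp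
  rw [leftAct_apply, h1, Coalgebra.coassoc_apply]
  simp only [leftAct, LinearMap.lTensor_comp, LinearMap.comp_apply]

lemma comul_rightAct (χ : C →ₗ[k] k) (c : C) :
    Coalgebra.comul (R := k) (rightAct χ c) =
      LinearMap.rTensor C (rightAct χ) (Coalgebra.comul c) := by
  have h1 : ∀ t : C ⊗[k] C, Coalgebra.comul (R := k) (TensorProduct.lid k C
      (LinearMap.rTensor C χ t)) = LinearMap.rTensor C
        ((TensorProduct.lid k C).toLinearMap ∘ₗ LinearMap.rTensor C χ)
          ((TensorProduct.assoc k C C C).symm (LinearMap.lTensor C Coalgebra.comul t)) := fun t => by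
    induction t using TensorProduct.induction_on with
    | zero => simp
    | add s t hs ht => simp only [map_add, hs, ht]
    | tmul x y =>
      simp only [LinearMap.lTensor_tmul, TensorProduct.lid_tmul, map_smul, LinearMap.rTensor_tmul]
      generalize Coalgebra.comul (R := k) y = s
      induction s using TensorProduct.induction_on with
      | zero => simp
      | add s t hs ht => simp only [map_add, TensorProduct.tmul_add, hs, ht, smul_add]
      | tmul z y => simp [TensorProduct.smul_tmul']
  rw [rightAct_apply, h1, Coalgebra.coassoc_symm_apply]
  simp only [rightAct, LinearMap.rTensor_comp, LinearMap.comp_apply]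

lemma leftAct_leftAct (ω χ : C →ₗ[k] k) (c : C) :
    leftAct ω (leftAct χ c) = leftAct (ω ∘ₗ leftAct χ) c := by
  rw [leftAct_apply, comul_leftAct, leftAct_apply, LinearMap.lTensor_comp, LinearMap.comp_apply]

lemma rightAct_rightAct (ω χ : C →ₗ[k] k) (c : C) :
    rightAct ω (rightAct χ c) = rightAct (ω ∘ₗ rightAct χ) c := by
  rw [rightAct_apply, comul_rightAct, rightAct_apply, LinearMap.rTensor_comp, LinearMap.comp_apply]

lemma rightAct_leftAct (ω χ : C →ₗ[k] k) (c : C) :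
    rightAct ω (leftAct χ c) = leftAct χ (rightAct ω c) := by
  rw [rightAct_apply, comul_leftAct, rightAct_apply]
  generalize Coalgebra.comul (R := k) c = t
  induction t using TensorProduct.induction_on with
  | zero => simp
  | add s t hs ht => simp only [map_add, hs, ht]
  | tmul x y => simp

@[simp] lemma leftAct_counit (c : C) : leftAct (Coalgebra.counit (R := k)) c = c := by
  simp [leftAct_apply]

@[simp] lemma rightAct_counit (c : C) : rightAct (Coalgebra.counit (R := k)) c = c := by
  simp [rightAct_apply]

lemma exists_finite_leftAct_mem (c : C) :
    ∃ U : Submodule k C, FiniteDimensional k U ∧ ∀ χ : C →ₗ[k] k, leftAct χ c ∈ U := by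
  simp only [leftAct_apply]
  generalize Coalgebra.comul (R := k) c = t
  induction t using TensorProduct.induction_on with
  | zero => exact ⟨⊥, inferInstance, by simp⟩
  | add s t hs ht =>
    obtain ⟨U, hU, h⟩ := hs
    obtain ⟨U', hU', h'⟩ := ht
    refine ⟨U ⊔ U', inferInstance, fun χ => ?_⟩
    simpa only [map_add] using
      add_mem (Submodule.mem_sup_left (h χ)) (Submodule.mem_sup_right (h' χ))
  | tmul x y =>
    refine ⟨k ∙ x, inferInstance, fun χ => ?_⟩
    simpa using Submodule.smul_mem _ _ (Submodule.mem_span_singleton_self x)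

lemma exists_finite_rightAct_mem (c : C) :
    ∃ U : Submodule k C, FiniteDimensional k U ∧ ∀ χ : C →ₗ[k] k, rightAct χ c ∈ U := by
  simp only [rightAct_apply]
  generalize Coalgebra.comul (R := k) c = t
  induction t using TensorProduct.induction_on with
  | zero => exact ⟨⊥, inferInstance, by simp⟩
  | add s t hs ht =>
    obtain ⟨U, hU, h⟩ := hs
    obtain ⟨U', hU', h'⟩ := ht
    refine ⟨U ⊔ U', inferInstance, fun χ => ?_⟩
    simpa only [map_add] using
      add_mem (Submodule.mem_sup_left (h χ)) (Submodule.mem_sup_right (h' χ))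
  | tmul x y =>
    refine ⟨k ∙ y, inferInstance, fun χ => ?_⟩
    simpa using Submodule.smul_mem _ _ (Submodule.mem_span_singleton_self y)

/-- Every element of a coalgebra lies in a finite-dimensional subcoalgebra. -/
theorem exists_finite_isSubcoalgebra_mem (c : C) :
    ∃ W : Submodule k C, IsSubcoalgebra k W ∧ FiniteDimensional k W ∧ c ∈ W := by
  -- The two actions commute, so these elements span the sub-bimodule generated by c. Its dimension
  -- is finite because each comultiplication has finitely many terms.
  let s : Set C := {x | ∃ ω χ : C →ₗ[k] k, x = rightAct ω (leftAct χ c)}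
  refine ⟨Submodule.span k s, ?_, ?_, ?_⟩
  · rw [isSubcoalgebra_iff]
    have key : ∀ T : C →ₗ[k] C, (∀ x ∈ s, T x ∈ s) →
        ∀ x ∈ Submodule.span k s, T x ∈ Submodule.span k s := fun T hT x hx => by
      have : Submodule.span k s ≤ (Submodule.span k s).comap T :=
        Submodule.span_le.2 fun y hy => Submodule.subset_span (hT y hy)
      exact this hx
    refine ⟨fun χ' => key _ ?_, fun ω' => key _ ?_⟩
    · rintro _ ⟨ω, χ, rfl⟩
      exact ⟨ω, χ' ∘ₗ leftAct χ, by rw [← rightAct_leftAct, leftAct_leftAct]⟩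
    · rintro _ ⟨ω, χ, rfl⟩
      exact ⟨ω' ∘ₗ rightAct ω, χ, by rw [rightAct_rightAct]⟩
  · obtain ⟨U, hU, h⟩ := exists_finite_leftAct_mem (k := k) c
    choose V hV h' using exists_finite_rightAct_mem (k := k) (C := C)
    let b := Module.finBasis k U
    have hle : Submodule.span k s ≤ ⨆ i, V (b i : C) := by
      refine Submodule.span_le.2 ?_
      rintro _ ⟨ω, χ, rfl⟩
      have : (leftAct χ c : C) = ∑ i, b.repr ⟨_, h χ⟩ i • (b i : C) := by
        have := congrArg Subtype.val (b.sum_repr ⟨leftAct χ c, h χ⟩)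
        rw [AddSubmonoidClass.coe_finsetSum] at this
        exact this.symm
      rw [this, map_sum]
      refine sum_mem fun i _ => ?_
      rw [map_smul]
      exact Submodule.smul_mem _ _ (Submodule.mem_iSup_of_mem i (h' _ ω))
    have : ∀ i, FiniteDimensional k (V (b i : C)) := fun i => hV _
    exact Submodule.finiteDimensional_of_le hle
  · exact Submodule.subset_span ⟨Coalgebra.counit, Coalgebra.counit, by simp⟩

lemma isSubcoalgebra_sSup (S : Set (Submodule k C)) (h : ∀ W ∈ S, IsSubcoalgebra k W) :
    IsSubcoalgebra k (sSup S) := by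
  rw [isSubcoalgebra_iff]
  have key : ∀ T : C →ₗ[k] C, (∀ W ∈ S, ∀ x ∈ W, T x ∈ W) → ∀ x ∈ sSup S, T x ∈ sSup S :=
    fun T hT x hx => by
      have : sSup S ≤ (sSup S).comap T := sSup_le fun W hW x hx => le_sSup hW (hT W hW x hx)
      exact this hx
  exact ⟨fun χ => key _ fun W hW => ((isSubcoalgebra_iff W).1 (h W hW)).1 χ,
    fun χ => key _ fun W hW => ((isSubcoalgebra_iff W).1 (h W hW)).2 χ⟩

lemma isSubcoalgebra_sup {V W : Submodule k C} (hV : IsSubcoalgebra k V)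
    (hW : IsSubcoalgebra k W) : IsSubcoalgebra k (V ⊔ W) := by
  rw [← sSup_pair]
  exact isSubcoalgebra_sSup _ (by rintro _ (rfl | rfl) <;> assumption)

lemma isSubcoalgebra_coradical : IsSubcoalgebra k (coradical k C) :=
  isSubcoalgebra_sSup _ fun _ hW => hW.isSubcoalgebra

end Actions

/-! ### Subcoalgebras as coalgebras -/

section SubcoalgebraType

variable {k C : Type*} [Field k] [AddCommGroup C] [Module k C] [Coalgebra k C]

omit [Coalgebra k C] in
lemma mapIncl_injective (W : Submodule k C) : Function.Injective (TensorProduct.mapIncl W W) :=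
  TensorProduct.map_injective_of_flat_flat _ _ W.injective_subtype W.injective_subtype

/-- The comultiplication of a subcoalgebra. -/
noncomputable def IsSubcoalgebra.comul {W : Submodule k C} (hW : IsSubcoalgebra k W) :
    W →ₗ[k] W ⊗[k] W :=
  (LinearEquiv.ofInjective _ (mapIncl_injective W)).symm.toLinearMap ∘ₗ
    (Coalgebra.comul ∘ₗ W.subtype).codRestrict _ fun x => hW x x.2

lemma IsSubcoalgebra.mapIncl_comul {W : Submodule k C} (hW : IsSubcoalgebra k W) (x : W) :
    TensorProduct.map W.subtype W.subtype (hW.comul x) = Coalgebra.comul (R := k) (x : C) := by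
  have := LinearEquiv.apply_symm_apply (LinearEquiv.ofInjective _ (mapIncl_injective W))
    ((Coalgebra.comul ∘ₗ W.subtype).codRestrict _ (fun x => hW x x.2) x)
  exact congrArg Subtype.val this

/-- A subcoalgebra is a coalgebra. -/
@[reducible] noncomputable def IsSubcoalgebra.coalgebra {W : Submodule k C}
    (hW : IsSubcoalgebra k W) : Coalgebra k W where
  comul := hW.comul
  counit := Coalgebra.counit ∘ₗ W.subtype
  coassoc := by
    have hinj : Function.Injective (TensorProduct.map W.subtype (TensorProduct.mapIncl W W)) :=
      TensorProduct.map_injective_of_flat_flat _ _ W.injective_subtype (mapIncl_injective W)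
    have hc : TensorProduct.mapIncl W W ∘ₗ hW.comul = Coalgebra.comul ∘ₗ W.subtype :=
      LinearMap.ext hW.mapIncl_comul
    ext x
    apply hinj
    have h1 : ∀ t : W ⊗[k] W, TensorProduct.map W.subtype (TensorProduct.mapIncl W W)
        (TensorProduct.assoc k W W W (LinearMap.rTensor W hW.comul t)) =
        TensorProduct.assoc k C C C (LinearMap.rTensor C Coalgebra.comul
          (TensorProduct.mapIncl W W t)) := fun t => by
      induction t using TensorProduct.induction_on with
      | zero => simp
      | add s t hs ht => simp only [map_add, hs, ht]
      | tmul x y =>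
        simp only [LinearMap.rTensor_tmul, TensorProduct.mapIncl, TensorProduct.map_tmul,
          Submodule.subtype_apply, ← hW.mapIncl_comul]
        generalize hW.comul x = s
        induction s using TensorProduct.induction_on with
        | zero => simp
        | add s t hs ht => simp only [map_add, TensorProduct.add_tmul, hs, ht]
        | tmul x z => simp
    have h2 : ∀ t : W ⊗[k] W, TensorProduct.map W.subtype (TensorProduct.mapIncl W W)
        (LinearMap.lTensor W hW.comul t) =
        LinearMap.lTensor C Coalgebra.comul (TensorProduct.mapIncl W W t) := fun t => by
      induction t using TensorProduct.induction_on with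
      | zero => simp
      | add s t hs ht => simp only [map_add, hs, ht]
      | tmul x y =>
        simp only [LinearMap.lTensor_tmul, TensorProduct.mapIncl, TensorProduct.map_tmul,
          Submodule.subtype_apply, ← hW.mapIncl_comul]
    simp only [LinearMap.comp_apply, LinearEquiv.coe_coe, h1, h2]
    simp only [TensorProduct.mapIncl, hW.mapIncl_comul, Coalgebra.coassoc_apply]
  rTensor_counit_comp_comul := by
    ext x
    apply (TensorProduct.lid k W).injective
    apply W.injective_subtype
    have h : ∀ t : W ⊗[k] W, W.subtype (TensorProduct.lid k W
        (LinearMap.rTensor W (Coalgebra.counit ∘ₗ W.subtype) t)) = TensorProduct.lid k C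
        (LinearMap.rTensor C Coalgebra.counit (TensorProduct.mapIncl W W t)) := fun t => by
      induction t using TensorProduct.induction_on with
      | zero => simp
      | add s t hs ht => simp only [map_add, hs, ht]
      | tmul x y => simp [TensorProduct.mapIncl]
    rw [LinearMap.comp_apply, h, TensorProduct.mapIncl, hW.mapIncl_comul]
    simp
  lTensor_counit_comp_comul := by
    ext x
    apply (TensorProduct.rid k W).injective
    apply W.injective_subtype
    have h : ∀ t : W ⊗[k] W, W.subtype (TensorProduct.rid k W
        (LinearMap.lTensor W (Coalgebra.counit ∘ₗ W.subtype) t)) = TensorProduct.rid k C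
        (LinearMap.lTensor C Coalgebra.counit (TensorProduct.mapIncl W W t)) := fun t => by
      induction t using TensorProduct.induction_on with
      | zero => simp
      | add s t hs ht => simp only [map_add, hs, ht]
      | tmul x y => simp [TensorProduct.mapIncl]
    rw [LinearMap.comp_apply, h, TensorProduct.mapIncl, hW.mapIncl_comul]
    simp

/-- The inclusion of a subcoalgebra, as a coalgebra map. -/
noncomputable def IsSubcoalgebra.incl {W : Submodule k C} (hW : IsSubcoalgebra k W) :
    letI := hW.coalgebra
    W →ₗc[k] C :=
  letI := hW.coalgebra
  { W.subtype with
    counit_comp := rfl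
    map_comp_comul := LinearMap.ext hW.mapIncl_comul }

end SubcoalgebraType

/-! ### Functoriality of convolution algebras -/

section Convolution

open WithConv

variable {k Y Z A A' : Type*} [Field k] [AddCommGroup Y] [Module k Y] [Coalgebra k Y]
  [AddCommGroup Z] [Module k Z] [Coalgebra k Z] [Ring A] [Algebra k A] [Ring A'] [Algebra k A']

/-- Composition with a coalgebra map, as a homomorphism of convolution algebras. -/
noncomputable def convPrecomp (A : Type*) [Ring A] [Algebra k A] (j : Z →ₗc[k] Y) :
    WithConv (Y →ₗ[k] A) →ₐ[k] WithConv (Z →ₗ[k] A) :=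
  AlgHom.ofLinearMap
    { toFun u := toConv (u.ofConv ∘ₗ (j : Z →ₗ[k] Y))
      map_add' _ _ := rfl
      map_smul' _ _ := rfl }
    (by
      ext z
      exact congrArg (algebraMap k A) (CoalgHomClass.counit_comp_apply j z))
    (fun u v => by
      apply ofConv_injective
      exact LinearMap.convMul_comp_coalgHom_distrib u v j)

/-- Composition with an algebra map, as a homomorphism of convolution algebras. -/
noncomputable def convPostcomp (Y : Type*) [AddCommGroup Y] [Module k Y] [Coalgebra k Y]
    (h : A →ₐ[k] A') : WithConv (Y →ₗ[k] A) →ₐ[k] WithConv (Y →ₗ[k] A') :=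
  AlgHom.ofLinearMap
    { toFun u := toConv (h.toLinearMap ∘ₗ u.ofConv)
      map_add' _ _ := by ext; simp
      map_smul' _ _ := by ext; simp }
    (by ext z; simp)
    (fun u v => by
      apply ofConv_injective
      exact LinearMap.algHom_comp_convMul_distrib h u v)

@[simp] lemma convPostcomp_apply (h : A →ₐ[k] A') (u : WithConv (Y →ₗ[k] A)) (y : Y) :
    convPostcomp Y h u y = h (u y) := rfl

lemma convPostcomp_includeLeft_mul (u v : WithConv (Y →ₗ[k] A)) (y : Y) :
    (convPostcomp Y (Algebra.TensorProduct.includeLeft : A →ₐ[k] A ⊗[k] A) u *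
      convPostcomp Y (Algebra.TensorProduct.includeRight : A →ₐ[k] A ⊗[k] A) v) y =
      TensorProduct.map u.ofConv v.ofConv (Coalgebra.comul y) := by
  rw [LinearMap.convMul_apply]
  generalize Coalgebra.comul (R := k) y = t
  induction t using TensorProduct.induction_on with
  | zero => simp
  | add s t hs ht => simp only [map_add, hs, ht]
  | tmul x y => simp

lemma convPostcomp_includeRight_mul (u v : WithConv (Y →ₗ[k] A)) (y : Y) :
    (convPostcomp Y (Algebra.TensorProduct.includeRight : A →ₐ[k] A ⊗[k] A) u *
      convPostcomp Y (Algebra.TensorProduct.includeLeft : A →ₐ[k] A ⊗[k] A) v) y =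
      TensorProduct.comm k A A (TensorProduct.map u.ofConv v.ofConv (Coalgebra.comul y)) := by
  rw [LinearMap.convMul_apply]
  generalize Coalgebra.comul (R := k) y = t
  induction t using TensorProduct.induction_on with
  | zero => simp
  | add s t hs ht => simp only [map_add, hs, ht]
  | tmul x y => simp

end Convolution

/-! ### Convolution inverses of coalgebra maps -/

section Cocommutative

open WithConv

variable {k Y A : Type*} [Field k] [AddCommGroup Y] [Module k Y] [Coalgebra k Y]
  [Ring A] [Bialgebra k A]

/-- The convolution inverse of a coalgebra map is an anticoalgebra map. -/
lemma comul_of_conv_inverse (φ : Y →ₗc[k] A) (ψ : Y →ₗ[k] A)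
    (h1 : toConv (φ : Y →ₗ[k] A) * toConv ψ = 1) (h2 : toConv ψ * toConv (φ : Y →ₗ[k] A) = 1)
    (y : Y) : Coalgebra.comul (R := k) (ψ y) =
      TensorProduct.comm k A A (TensorProduct.map ψ ψ (Coalgebra.comul y)) := by
  let inl := convPostcomp Y (Algebra.TensorProduct.includeLeft : A →ₐ[k] A ⊗[k] A)
  let inr := convPostcomp Y (Algebra.TensorProduct.includeRight : A →ₐ[k] A ⊗[k] A)
  let Δ := convPostcomp Y (Bialgebra.comulAlgHom k A)
  -- In Hom(Y, A ⊗ A), Δ ∘ φ is the product of φ ⊗ 1 and 1 ⊗ φ. Its left inverse (1 ⊗ ψ) * (ψ ⊗ 1)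
  -- must then equal its right inverse Δ ∘ ψ.
  have hφ : Δ (toConv (φ : Y →ₗ[k] A)) =
      inl (toConv (φ : Y →ₗ[k] A)) * inr (toConv (φ : Y →ₗ[k] A)) := by
    ext y
    refine Eq.trans ?_ (convPostcomp_includeLeft_mul _ _ y).symm
    exact (CoalgHomClass.map_comp_comul_apply φ y).symm
  have hr : Δ (toConv (φ : Y →ₗ[k] A)) * Δ (toConv ψ) = 1 := by rw [← map_mul, h1, map_one]
  have hl : inr (toConv ψ) * inl (toConv ψ) * Δ (toConv (φ : Y →ₗ[k] A)) = 1 := by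
    rw [hφ, mul_assoc, ← mul_assoc (inl _) (inl _), ← map_mul inl, h2, map_one, one_mul,
      ← map_mul, h2, map_one]
  have := left_inv_eq_right_inv hl hr
  rw [← convPostcomp_includeRight_mul (toConv ψ) (toConv ψ) y]
  exact (congrArg (fun u : WithConv (Y →ₗ[k] A ⊗[k] A) => u y) this).symm

/-- If two coalgebra maps are convolution inverse to each other, then their images are
cocommutative. -/
lemma comm_comul_of_conv_inverse (φ ψ : Y →ₗc[k] A)
    (h1 : toConv (φ : Y →ₗ[k] A) * toConv (ψ : Y →ₗ[k] A) = 1)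
    (h2 : toConv (ψ : Y →ₗ[k] A) * toConv (φ : Y →ₗ[k] A) = 1) (y : Y) :
    TensorProduct.comm k A A (Coalgebra.comul (R := k) (φ y)) = Coalgebra.comul (φ y) := by
  -- As the inverse of ψ, φ reverses the comultiplication, which it also preserves.
  have h := comul_of_conv_inverse ψ (φ : Y →ₗ[k] A) h2 h1 y
  have h' := CoalgHomClass.map_comp_comul_apply φ y
  rw [← h']
  exact h.symm.trans h'.symm

end Cocommutative

section Antipode

open WithConv

variable {k Z B : Type*} [Field k] [AddCommGroup Z] [Module k Z] [Coalgebra k Z]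
  [Ring B] [HopfAlgebra k B]

/-- The antipode composed with a coalgebra map from a cocommutative coalgebra is a coalgebra
map. -/
noncomputable def antipodeComp [Coalgebra.IsCocomm k Z] (j : Z →ₗc[k] B) : Z →ₗc[k] B where
  __ := HopfAlgebra.antipode k ∘ₗ (j : Z →ₗ[k] B)
  counit_comp := by ext z; simp
  map_comp_comul := by
    ext z
    have h1 : toConv (j : Z →ₗ[k] B) * toConv (HopfAlgebra.antipode k ∘ₗ (j : Z →ₗ[k] B)) = 1 := by
      have := congrArg (convPrecomp B j) (LinearMap.id_mul_antipode (R := k) (C := B))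
      rwa [map_mul, map_one] at this
    have h2 : toConv (HopfAlgebra.antipode k ∘ₗ (j : Z →ₗ[k] B)) * toConv (j : Z →ₗ[k] B) = 1 := by
      have := congrArg (convPrecomp B j) (LinearMap.antipode_mul_id (R := k) (C := B))
      rwa [map_mul, map_one] at this
    have := comul_of_conv_inverse j _ h1 h2 z
    rw [← TensorProduct.map_comm, Coalgebra.comm_comul] at this
    exact this.symm

end Antipode

/-! ### Convolution invertibility of measurings -/

section Measuring

open WithConv

variable {k B C A : Type*} [Field k] [Ring B] [HopfAlgebra k B]
    [AddCommGroup C] [Module k C] [Coalgebra k C] [Ring A] [Algebra k A]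

/-- The map u ↦ f ∘ (u ⊗ id) is multiplicative for convolution, so it carries the inverse pair id, S
to an inverse pair. -/
lemma IsMeasuring.rTensor_conv_mul {f : B ⊗[k] C →ₗ[k] A} (hf : IsMeasuring f)
    (u v : WithConv (B →ₗ[k] B)) :
    toConv (f ∘ₗ LinearMap.rTensor C u.ofConv) * toConv (f ∘ₗ LinearMap.rTensor C v.ofConv) =
      toConv (f ∘ₗ LinearMap.rTensor C (u * v).ofConv) := by
  ext b c
  change (toConv (f ∘ₗ LinearMap.rTensor C u.ofConv) *
    toConv (f ∘ₗ LinearMap.rTensor C v.ofConv)) (b ⊗ₜ[k] c) = f ((u * v) b ⊗ₜ c)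
  rw [LinearMap.convMul_apply, LinearMap.convMul_apply, TensorProduct.comul_tmul]
  generalize Coalgebra.comul (R := k) b = s
  induction s using TensorProduct.induction_on with
  | zero => simp
  | add s t hs ht => simp only [map_add, TensorProduct.add_tmul, hs, ht]
  | tmul b b' =>
    rw [TensorProduct.map_tmul, LinearMap.mul'_apply, hf.map_mul_tmul]
    generalize Coalgebra.comul (R := k) c = t
    induction t using TensorProduct.induction_on with
    | zero => simp
    | add s t hs ht => simp only [map_add, TensorProduct.tmul_add, hs, ht]
    | tmul c c' => simp

lemma IsMeasuring.rTensor_conv_one {f : B ⊗[k] C →ₗ[k] A} (hf : IsMeasuring f) :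
    toConv (f ∘ₗ LinearMap.rTensor C (1 : WithConv (B →ₗ[k] B)).ofConv) = 1 := by
  ext b c
  change f ((1 : WithConv (B →ₗ[k] B)) b ⊗ₜ c) = algebraMap k A (Coalgebra.counit (b ⊗ₜ[k] c))
  rw [LinearMap.convOne_apply, Algebra.algebraMap_eq_smul_one, ← TensorProduct.smul_tmul',
    map_smul, hf.map_one_tmul, TensorProduct.counit_tmul, Algebra.smul_def, ← map_mul, smul_eq_mul,
    mul_comm]

/-- A measuring by a Hopf algebra is convolution invertible. -/
lemma IsMeasuring.conv_mul_antipode {f : B ⊗[k] C →ₗ[k] A} (hf : IsMeasuring f) :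
    toConv f * toConv (f ∘ₗ LinearMap.rTensor C (HopfAlgebra.antipode k)) = 1 := by
  have := hf.rTensor_conv_mul (toConv LinearMap.id) (toConv (HopfAlgebra.antipode k))
  rw [LinearMap.id_mul_antipode, hf.rTensor_conv_one] at this
  simpa using this

lemma IsMeasuring.antipode_conv_mul {f : B ⊗[k] C →ₗ[k] A} (hf : IsMeasuring f) :
    toConv (f ∘ₗ LinearMap.rTensor C (HopfAlgebra.antipode k)) * toConv f = 1 := by
  have := hf.rTensor_conv_mul (toConv (HopfAlgebra.antipode k)) (toConv LinearMap.id)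
  rw [LinearMap.antipode_mul_id, hf.rTensor_conv_one] at this
  simpa using this

end Measuring

/-! ### The coradical and the Jacobson radical of the dual -/

section SimpleModule

variable {k Λ U : Type*} [Field k] [Ring Λ] [Algebra k Λ] [AddCommGroup U] [Module k U]
  [Module Λ U] [IsScalarTower k Λ U]

/-- The annihilator of a finite-dimensional simple module is a maximal two-sided ideal. -/
lemma eq_top_of_annihilator_le [FiniteDimensional k U] [IsSimpleModule Λ U] (I : Ideal Λ)
    [I.IsTwoSided] (h : Module.annihilator Λ U ≤ I) (hI : ¬ I ≤ Module.annihilator Λ U) :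
    I = ⊤ := by
  let b := Module.finBasis k U
  -- Evaluation on a k-basis of U embeds Λ / Ann(U) in a finite power of U. This power is
  -- semisimple, so the image of I has a complement there.
  let φ : Λ →ₗ[Λ] (Fin (Module.finrank k U) → U) :=
    LinearMap.pi fun i => LinearMap.toSpanSingleton Λ U (b i)
  have hφ : ∀ r i, φ r i = r • b i := fun _ _ => rfl
  have hker : ∀ r, φ r = 0 → r ∈ Module.annihilator Λ U := fun r hr => by
    have h0 : Algebra.lsmul k k U r = 0 := b.ext fun i => by
      have := congrFun hr i
      rw [hφ] at this
      simpa using this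
    exact Module.mem_annihilator.2 fun u => by simpa using LinearMap.congr_fun h0 u
  obtain ⟨Q, hQ⟩ := exists_isCompl (Submodule.map φ I)
  -- A nonzero coordinate of φ s generates U. As φ(I Λ s) lies in φ(I) ∩ Q = 0, the ideal I would
  -- annihilate U.
  have hx : ∀ s, φ s ∈ Q → φ s = 0 := fun s hs => by
    by_contra hne
    obtain ⟨i, hi⟩ := Function.ne_iff.1 hne
    refine hI fun r hr => Module.mem_annihilator.2 fun u => ?_
    obtain ⟨t, rfl⟩ := IsSimpleModule.toSpanSingleton_surjective Λ hi u
    have hmem : φ ((r * t) * s) ∈ Submodule.map φ I :=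
      Submodule.mem_map_of_mem (I.mul_mem_right _ (I.mul_mem_right _ hr))
    have hmem' : φ ((r * t) * s) ∈ Q := by
      have : φ ((r * t) * s) = (r * t) • φ s := by rw [← smul_eq_mul, map_smul]
      exact this ▸ Q.smul_mem _ hs
    have h0 := Submodule.disjoint_def.1 hQ.disjoint _ hmem hmem'
    have := congrFun h0 i
    rw [hφ, mul_smul] at this
    rw [LinearMap.toSpanSingleton_apply, ← mul_smul]
    exact this
  have h1 : φ 1 ∈ Submodule.map φ I ⊔ Q := hQ.sup_eq_top ▸ trivial
  obtain ⟨_, ⟨r, hr, rfl⟩, q, hq, hrq⟩ := Submodule.mem_sup.1 h1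
  have hq' : q = φ (1 - r) := by rw [map_sub, ← hrq]; abel
  subst hq'
  have := h (hker _ (hx _ hq))
  rw [Ideal.eq_top_iff_one]
  simpa using add_mem this hr

end SimpleModule

section Perp

open WithConv

variable {k D : Type*} [Field k] [AddCommGroup D] [Module k D] [Coalgebra k D]

lemma conv_apply_eq_leftAct (χ ω : WithConv (D →ₗ[k] k)) (d : D) :
    (χ * ω) d = χ (leftAct ω.ofConv d) := by
  rw [LinearMap.convMul_apply, leftAct_apply]
  generalize Coalgebra.comul (R := k) d = t
  induction t using TensorProduct.induction_on with
  | zero => simp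
  | add s t hs ht => simp only [map_add, hs, ht]
  | tmul x y => simp [mul_comm]

lemma conv_apply_eq_rightAct (χ ω : WithConv (D →ₗ[k] k)) (d : D) :
    (χ * ω) d = ω (rightAct χ.ofConv d) := by
  rw [LinearMap.convMul_apply, rightAct_apply]
  generalize Coalgebra.comul (R := k) d = t
  induction t using TensorProduct.induction_on with
  | zero => simp
  | add s t hs ht => simp only [map_add, hs, ht]
  | tmul x y => simp

/-- The ideal of the dual algebra of functionals vanishing on a subcoalgebra. -/
def IsSubcoalgebra.perp {W : Submodule k D} (hW : IsSubcoalgebra k W) :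
    Ideal (WithConv (D →ₗ[k] k)) where
  carrier := {χ | ∀ d ∈ W, χ d = 0}
  add_mem' h h' d hd := by
    have := h d hd
    have := h' d hd
    simp_all
  zero_mem' _ _ := rfl
  smul_mem' ω χ h d hd := by
    rw [smul_eq_mul, conv_apply_eq_rightAct]
    exact h _ (((isSubcoalgebra_iff W).1 hW).2 _ _ hd)

instance IsSubcoalgebra.isTwoSided_perp {W : Submodule k D} (hW : IsSubcoalgebra k W) :
    hW.perp.IsTwoSided where
  mul_mem_of_left {χ} ω h := fun d hd => by
    rw [conv_apply_eq_leftAct]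
    exact h _ (((isSubcoalgebra_iff W).1 hW).1 _ _ hd)

/-- The elements of a coalgebra on which all functionals in an ideal of the dual vanish. -/
def coperp (I : Ideal (WithConv (D →ₗ[k] k))) : Submodule k D where
  carrier := {d | ∀ χ ∈ I, χ d = 0}
  add_mem' h h' χ hχ := by rw [map_add, h χ hχ, h' χ hχ, add_zero]
  zero_mem' χ _ := map_zero _
  smul_mem' c d h χ hχ := by rw [map_smul, h χ hχ, smul_zero]

lemma isSubcoalgebra_coperp (I : Ideal (WithConv (D →ₗ[k] k))) [I.IsTwoSided] :
    IsSubcoalgebra k (coperp I) := by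
  rw [isSubcoalgebra_iff]
  refine ⟨fun ω d hd χ hχ => ?_, fun ω d hd χ hχ => ?_⟩
  · rw [← ofConv_toConv ω, ← conv_apply_eq_leftAct]
    exact hd _ (I.mul_mem_right _ hχ)
  · rw [← ofConv_toConv ω, ← conv_apply_eq_rightAct]
    exact hd _ (I.mul_mem_left _ hχ)

lemma IsSubcoalgebra.coperp_perp {W : Submodule k D} (hW : IsSubcoalgebra k W) :
    coperp hW.perp = W := by
  refine le_antisymm (fun d hd => ?_) fun d hd χ hχ => hχ d hd
  by_contra hdW
  obtain ⟨χ, hχ, hχW⟩ := Submodule.exists_le_ker_of_notMem hdW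
  exact hχ (hd (toConv χ) fun w hw => hχW hw)

/-- Double annihilator theorem; finite dimension is essential here, unlike in `coperp_perp`. -/
lemma mem_of_forall_coperp [FiniteDimensional k D] (I : Ideal (WithConv (D →ₗ[k] k)))
    (χ : WithConv (D →ₗ[k] k)) (h : ∀ d ∈ coperp I, χ d = 0) : χ ∈ I := by
  let J : Subspace k (Module.Dual k D) :=
    (I.restrictScalars k).map (WithConv.linearEquiv k (D →ₗ[k] k)).toLinearMap
  have hJ : χ.ofConv ∈ J.dualCoannihilator.dualAnnihilator := by
    rw [Submodule.mem_dualAnnihilator]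
    intro d hd
    refine h d fun ω hω => ?_
    rw [Submodule.mem_dualCoannihilator] at hd
    exact hd ω.ofConv ⟨ω, hω, rfl⟩
  rw [Subspace.dualCoannihilator_dualAnnihilator_eq] at hJ
  obtain ⟨ω, hω, h⟩ := hJ
  have : ω = χ := ofConv_injective h
  exact this ▸ hω

/-- The functionals vanishing on the coradical of a finite-dimensional coalgebra form a nilpotent
ideal. -/
theorem isNilpotent_perp_coradical [FiniteDimensional k D] :
    IsNilpotent (isSubcoalgebra_coradical (k := k) (C := D)).perp := by
  have hfin : FiniteDimensional k (WithConv (D →ₗ[k] k)) :=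
    (WithConv.linearEquiv k (D →ₗ[k] k)).symm.finiteDimensional
  have : IsArtinianRing (WithConv (D →ₗ[k] k)) := IsArtinianRing.of_finite k _
  -- The Jacobson radical of an Artinian ring is nilpotent, so it suffices to put the perp inside
  -- every maximal left ideal.
  obtain ⟨n, hn⟩ := IsSemiprimaryRing.isNilpotent (R := WithConv (D →ₗ[k] k))
  refine ⟨n, le_bot_iff.1 (le_trans (Ideal.pow_right_mono ?_ n) hn.le)⟩
  rw [Ring.jacobson_eq_sInf_isMaximal]
  refine le_sInf fun 𝔪 (h𝔪 : 𝔪.IsMaximal) => ?_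
  let U := WithConv (D →ₗ[k] k) ⧸ 𝔪
  have : IsSimpleModule (WithConv (D →ₗ[k] k)) U := isSimpleModule_iff_isCoatom.2 h𝔪.out
  let I := Module.annihilator (WithConv (D →ₗ[k] k)) U
  have hI𝔪 : I ≤ 𝔪 := fun r hr => by
    have := Module.mem_annihilator.1 hr (Submodule.Quotient.mk 1)
    rwa [← Submodule.Quotient.mk_smul, smul_eq_mul, mul_one, Submodule.Quotient.mk_eq_zero] at this
  refine le_trans ?_ hI𝔪
  -- A subcoalgebra of `coperp I` has a two-sided perp containing I, and I is maximal among
  -- two-sided ideals as the annihilator of a simple module.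
  have hsimple : IsSimpleSubcoalgebra k (coperp I) := by
    refine ⟨isSubcoalgebra_coperp I, fun h => ?_, fun V hV hVI => ?_⟩
    · refine h𝔪.ne_top (top_le_iff.1 (le_trans (fun χ _ => ?_) hI𝔪))
      refine mem_of_forall_coperp I χ fun d hd => ?_
      rw [h, Submodule.mem_bot] at hd
      rw [hd, map_zero]
    · have hle : I ≤ hV.perp := fun χ hχ d hd => hVI hd χ hχ
      by_cases hV' : hV.perp ≤ I
      · right
        rw [← hV.coperp_perp, le_antisymm hle hV']
      · left
        have htop := eq_top_of_annihilator_le (k := k) hV.perp hle hV'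
        rw [← hV.coperp_perp, htop, eq_bot_iff]
        intro d hd
        by_contra hd0
        obtain ⟨χ, hχ, -⟩ := Submodule.exists_le_ker_of_notMem hd0
        exact hχ (hd (toConv χ) trivial)
  intro χ hχ
  exact mem_of_forall_coperp I χ fun d hd =>
    hχ d ((le_sSup hsimple : coperp I ≤ coradical k D) hd)

end Perp

/-! ### Coradicals under injective coalgebra maps -/

section Transfer

variable {k B D : Type*} [Field k] [AddCommGroup D] [Module k D] [Coalgebra k D]
  [AddCommGroup B] [Module k B] [Coalgebra k B]

lemma map_leftAct (j : D →ₗc[k] B) (χ : B →ₗ[k] k) (d : D) :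
    j (leftAct (χ ∘ₗ (j : D →ₗ[k] B)) d) = leftAct χ (j d) := by
  rw [leftAct_apply, leftAct_apply, ← CoalgHomClass.map_comp_comul_apply j d]
  generalize Coalgebra.comul (R := k) d = t
  induction t using TensorProduct.induction_on with
  | zero => simp
  | add s t hs ht => simp only [map_add, hs, ht]
  | tmul x y => simp

lemma map_rightAct (j : D →ₗc[k] B) (χ : B →ₗ[k] k) (d : D) :
    j (rightAct (χ ∘ₗ (j : D →ₗ[k] B)) d) = rightAct χ (j d) := by
  rw [rightAct_apply, rightAct_apply, ← CoalgHomClass.map_comp_comul_apply j d]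
  generalize Coalgebra.comul (R := k) d = t
  induction t using TensorProduct.induction_on with
  | zero => simp
  | add s t hs ht => simp only [map_add, hs, ht]
  | tmul x y => simp

lemma IsSubcoalgebra.map {V : Submodule k D} (hV : IsSubcoalgebra k V) (j : D →ₗc[k] B) :
    IsSubcoalgebra k (V.map (j : D →ₗ[k] B)) := by
  rw [isSubcoalgebra_iff] at hV ⊢
  constructor
  · rintro χ _ ⟨d, hd, rfl⟩
    exact ⟨_, hV.1 _ d hd, map_leftAct j χ d⟩
  · rintro χ _ ⟨d, hd, rfl⟩
    exact ⟨_, hV.2 _ d hd, map_rightAct j χ d⟩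

/-- By injectivity of j, every functional on D factors through B, so the actions on D are restricted
from B. -/
lemma IsSubcoalgebra.comap {W : Submodule k B} (hW : IsSubcoalgebra k W) (j : D →ₗc[k] B)
    (hj : Function.Injective j) : IsSubcoalgebra k (W.comap (j : D →ₗ[k] B)) := by
  obtain ⟨p, hp⟩ := LinearMap.exists_leftInverse_of_injective (j : D →ₗ[k] B)
    (LinearMap.ker_eq_bot.2 hj)
  rw [isSubcoalgebra_iff] at hW ⊢
  have h : ∀ χ : D →ₗ[k] k, χ = (χ ∘ₗ p) ∘ₗ (j : D →ₗ[k] B) := fun χ => by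
    rw [LinearMap.comp_assoc, hp, LinearMap.comp_id]
  constructor
  · intro χ d hd
    rw [h χ]
    rw [Submodule.mem_comap]
    exact (congrArg (· ∈ W) (map_leftAct j (χ ∘ₗ p) d)).mpr (hW.1 (χ ∘ₗ p) (j d) hd)
  · intro χ d hd
    rw [h χ]
    rw [Submodule.mem_comap]
    exact (congrArg (· ∈ W) (map_rightAct j (χ ∘ₗ p) d)).mpr (hW.2 (χ ∘ₗ p) (j d) hd)

lemma IsSimpleSubcoalgebra.map {V : Submodule k D} (hV : IsSimpleSubcoalgebra k V)
    (j : D →ₗc[k] B) (hj : Function.Injective j) :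
    IsSimpleSubcoalgebra k (V.map (j : D →ₗ[k] B)) := by
  refine ⟨hV.isSubcoalgebra.map j, fun h => hV.ne_bot ?_, fun W hW hWV => ?_⟩
  · exact Submodule.map_injective_of_injective (f := (j : D →ₗ[k] B)) hj
      (h.trans (Submodule.map_bot _).symm)
  · have hle : W.comap (j : D →ₗ[k] B) ≤ V := fun d hd => by
      obtain ⟨d', hd', h⟩ := hWV hd
      exact hj h ▸ hd'
    have hWmap : (W.comap (j : D →ₗ[k] B)).map (j : D →ₗ[k] B) = W :=
      Submodule.map_comap_eq_self (hWV.trans LinearMap.map_le_range)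
    rcases hV.eq_bot_or_eq _ (hW.comap j hj) hle with h | h
    · left; rw [← hWmap, h, Submodule.map_bot]
    · right; rw [← hWmap, h]

lemma map_coradical_le (j : D →ₗc[k] B) (hj : Function.Injective j) :
    (coradical k D).map (j : D →ₗ[k] B) ≤ coradical k B := by
  rw [Submodule.map_le_iff_le_comap]
  refine sSup_le fun V hV => ?_
  rw [← Submodule.map_le_iff_le_comap]
  exact le_sSup (IsSimpleSubcoalgebra.map hV j hj)

lemma HasCocommCoradical.of_injective (hB : HasCocommCoradical k B) (j : D →ₗc[k] B)
    (hj : Function.Injective j) : HasCocommCoradical k D := fun x hx => by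
  have hinj : Function.Injective (TensorProduct.map (j : D →ₗ[k] B) (j : D →ₗ[k] B)) :=
    TensorProduct.map_injective_of_flat_flat _ _ hj hj
  apply hinj
  rw [TensorProduct.map_comm]
  have h := CoalgHomClass.map_comp_comul_apply j x
  have h' := hB _ (map_coradical_le j hj ⟨x, hx, rfl⟩)
  exact (congrArg _ h).trans (h'.trans h.symm)

end Transfer

/-! ### Descent of right inverses to a commutative subalgebra -/

section RightInverse

/-- A finite faithful module over a commutative ring surjects onto every residue field. -/
lemma exists_surjective_to_quotient {M V : Type*} [CommRing M] [AddCommGroup V] [Module M V]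
    [Module.Finite M V] (hV : ∀ m : M, (∀ v : V, m • v = 0) → m = 0) (p : Ideal M)
    [p.IsMaximal] : ∃ l : V →ₗ[M] M ⧸ p, Function.Surjective l := by
  let _ : Field (M ⧸ p) := Ideal.Quotient.field p
  -- By Nakayama, equality would give r ∈ 1 + p annihilating V; then r = 0 and 1 ∈ p.
  have hne : p • (⊤ : Submodule M V) ≠ ⊤ := fun h => by
    obtain ⟨r, hr, hr0⟩ := Submodule.exists_sub_one_mem_and_smul_eq_zero_of_fg_of_le_smul p
      (⊤ : Submodule M V) Module.Finite.fg_top h.ge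
    have : r = 0 := hV r fun v => hr0 v trivial
    exact Ideal.IsPrime.ne_top' ((Ideal.eq_top_iff_one p).2 (by simpa [this] using hr))
  have : Nontrivial (V ⧸ p • (⊤ : Submodule M V)) := Submodule.Quotient.nontrivial_iff.2 hne
  obtain ⟨x, hx⟩ := exists_ne (0 : V ⧸ p • (⊤ : Submodule M V))
  obtain ⟨l, hl⟩ : ∃ l : Module.Dual (M ⧸ p) (V ⧸ p • (⊤ : Submodule M V)), l x ≠ 0 := by
    by_contra! h
    exact hx ((Module.forall_dual_apply_eq_zero_iff (M ⧸ p) x).1 h)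
  refine ⟨(l.restrictScalars M) ∘ₗ Submodule.mkQ _, ?_⟩
  rw [LinearMap.coe_comp]
  refine Function.Surjective.comp ?_ (Submodule.mkQ_surjective _)
  intro y
  refine ⟨(y / l x) • x, ?_⟩
  simp [hl]

variable {k M R A : Type*} [Field k] [CommRing M] [Algebra k M] [Ring R] [Algebra k R]
  [Ring A] [Algebra k A]

/-- An M-linear surjection l : R → M/p transports the right inverse. It need not be multiplicative,
since only left multiplication by Φ has to pass through it. -/
lemma exists_right_inv_quotient [FiniteDimensional k R] (i : M →ₐ[k] R)
    (hi : Function.Injective i) (Φ : M ⊗[k] A)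
    (Ψ : R ⊗[k] A) (hΨ : Algebra.TensorProduct.map i (AlgHom.id k A) Φ * Ψ = 1)
    (p : Ideal M) [p.IsMaximal] :
    ∃ y : (M ⧸ p) ⊗[k] A,
      Algebra.TensorProduct.map (Ideal.Quotient.mkₐ k p) (AlgHom.id k A) Φ * y = 1 := by
  -- M need not be central in R, so R is used only as a left M-module.
  let _ : Module M R := Module.compHom R i.toRingHom
  have hsmul : ∀ (m : M) (r : R), m • r = i m * r := fun _ _ => rfl
  have : IsScalarTower k M R := ⟨fun c m r => by simp [hsmul]⟩
  have : Module.Finite M R := Module.Finite.of_restrictScalars_finite k M R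
  obtain ⟨l, hl⟩ := exists_surjective_to_quotient (V := R) (fun m hm => hi (by
    simpa [hsmul] using hm 1)) p
  obtain ⟨r, hr⟩ := hl 1
  let L : R ⊗[k] A →ₗ[k] (M ⧸ p) ⊗[k] A := LinearMap.rTensor A (l.restrictScalars k)
  have key : ∀ (Φ : M ⊗[k] A) (x : R ⊗[k] A),
      L (Algebra.TensorProduct.map i (AlgHom.id k A) Φ * x) =
        Algebra.TensorProduct.map (Ideal.Quotient.mkₐ k p) (AlgHom.id k A) Φ * L x := fun Φ x => by
    induction Φ using TensorProduct.induction_on with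
    | zero => simp
    | add s t hs ht => simp only [map_add, add_mul, hs, ht]
    | tmul m a =>
      induction x using TensorProduct.induction_on with
      | zero => simp
      | add s t hs ht => simp only [map_add, mul_add, hs, ht]
      | tmul r b =>
        have : l (i m * r) = Ideal.Quotient.mk p m * l r := by
          rw [← hsmul, map_smul]; rfl
        simp [L, this]
  refine ⟨L (Ψ * (r ⊗ₜ 1)), ?_⟩
  rw [← key, ← mul_assoc, hΨ, one_mul]
  simp [L, hr, Algebra.TensorProduct.one_def]

/-- If the image of `Φ ∈ M ⊗ A` in `R ⊗ A` is right invertible, with `M` a finite-dimensional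
commutative subalgebra of the finite-dimensional algebra `R`, then so is `Φ`. -/
theorem exists_right_inv_of_injective [FiniteDimensional k M] [FiniteDimensional k R]
    (i : M →ₐ[k] R) (hi : Function.Injective i) (Φ : M ⊗[k] A) (Ψ : R ⊗[k] A)
    (hΨ : Algebra.TensorProduct.map i (AlgHom.id k A) Φ * Ψ = 1) : ∃ y : M ⊗[k] A, Φ * y = 1 := by
  have : IsArtinianRing M := IsArtinianRing.of_finite k M
  let N : Submodule M (M ⊗[k] A) := LinearMap.range (LinearMap.mulLeft M Φ)
  -- N is the right ideal generated by Φ; right invertibility modulo p means that N fills M ⊗ A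
  -- modulo p.
  have hp : ∀ p : Ideal M, p.IsPrime → N ⊔ p • ⊤ = ⊤ := fun p hp => by
    have : p.IsMaximal := IsArtinianRing.isMaximal_of_isPrime p
    obtain ⟨y, hy⟩ := exists_right_inv_quotient i hi Φ Ψ hΨ p
    have hsurj : Function.Surjective
        (Algebra.TensorProduct.map (Ideal.Quotient.mkₐ k p) (AlgHom.id k A)) :=
      TensorProduct.map_surjective (Ideal.Quotient.mkₐ_surjective k p) Function.surjective_id
    obtain ⟨y, rfl⟩ := hsurj y
    rw [← map_mul, ← map_one (Algebra.TensorProduct.map (Ideal.Quotient.mkₐ k p) (AlgHom.id k A)),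
      ← sub_eq_zero, ← map_sub] at hy
    have hker : ∀ z : M ⊗[k] A, Algebra.TensorProduct.map (Ideal.Quotient.mkₐ k p)
        (AlgHom.id k A) z = 0 → z ∈ (p • ⊤ : Submodule M (M ⊗[k] A)) := fun z hz => by
      have hex := rTensor_exact A (f := (p.restrictScalars k).subtype)
        (g := (Ideal.Quotient.mkₐ k p).toLinearMap)
        (by
          intro x
          simp [Ideal.Quotient.eq_zero_iff_mem]) (Ideal.Quotient.mkₐ_surjective k p)
      obtain ⟨w, rfl⟩ := (hex z).1 hz
      induction w using TensorProduct.induction_on with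
      | zero => simp
      | add s t hs ht =>
        rw [map_add]
        exact add_mem (hs (hex.apply_apply_eq_zero s)) (ht (hex.apply_apply_eq_zero t))
      | tmul m a =>
        have : (LinearMap.rTensor A (p.restrictScalars k).subtype) (m ⊗ₜ[k] a) =
            (m : M) • ((1 : M) ⊗ₜ[k] a) := by
          simp [TensorProduct.smul_tmul']
        rw [this]
        exact Submodule.smul_mem_smul m.2 trivial
    refine eq_top_iff.2 fun z _ => ?_
    have : z = Φ * (y * z) - (Φ * y - 1) * z := by rw [sub_mul, one_mul, mul_assoc]; abel
    rw [this]
    exact sub_mem (Submodule.mem_sup_left ⟨y * z, rfl⟩)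
      (Submodule.mem_sup_right (hker _ (by rw [map_mul, hy, zero_mul])))
  -- Some finite product of primes of M is zero. Absorbing its factors one by one replaces the usual
  -- Nakayama lemma, as M ⊗ A need not be finite over M.
  obtain ⟨Z, hZ⟩ := PrimeSpectrum.exists_primeSpectrum_prod_le M (⊥ : Ideal M)
  have hprod : ∀ Z : Multiset (PrimeSpectrum M),
      N ⊔ (Multiset.map PrimeSpectrum.asIdeal Z).prod • ⊤ = ⊤ := fun Z => by
    induction Z using Multiset.induction_on with
    | empty => simp
    | cons q Z ih =>
      rw [eq_top_iff]
      calc (⊤ : Submodule M (M ⊗[k] A)) = N ⊔ q.asIdeal • ⊤ := (hp _ q.2).symm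
        _ = N ⊔ q.asIdeal • (N ⊔ (Multiset.map PrimeSpectrum.asIdeal Z).prod • ⊤) := by rw [ih]
        _ ≤ _ := by
          rw [Submodule.smul_sup, ← Submodule.mul_smul, Multiset.map_cons, Multiset.prod_cons,
            ← sup_assoc]
          exact sup_le_sup_right (sup_le le_rfl Submodule.smul_le_right) _
  have h := hprod Z
  rw [le_bot_iff.1 hZ, Submodule.bot_smul, sup_bot_eq] at h
  have h1 : (1 : M ⊗[k] A) ∈ N := h ▸ trivial
  obtain ⟨y, hy⟩ := h1
  exact ⟨y, hy⟩

end RightInverse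

/-! ### Translation from dual algebras to convolution algebras -/

section DualTensor

open WithConv

variable {k Y P A : Type*} [Field k] [AddCommGroup Y] [Module k Y] [Coalgebra k Y]
  [AddCommGroup P] [Module k P] [Coalgebra k P] [Ring A] [Algebra k A]

variable (k Y A) in
/-- The canonical map `Y* ⊗ A → Hom(Y, A)`, as a homomorphism of convolution algebras. -/
noncomputable def dualTensorConv :
    WithConv (Y →ₗ[k] k) ⊗[k] A →ₐ[k] WithConv (Y →ₗ[k] A) :=
  Algebra.TensorProduct.algHomOfLinearMapTensorProduct
    ((WithConv.linearEquiv k (Y →ₗ[k] A)).symm.toLinearMap ∘ₗ dualTensorHom k Y A ∘ₗ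
      LinearMap.rTensor A (WithConv.linearEquiv k (Y →ₗ[k] k)).toLinearMap)
    (fun χ χ' a a' => by
      ext y
      change (χ * χ') y • (a * a') = (toConv (dualTensorHom k Y A (χ.ofConv ⊗ₜ[k] a)) *
        toConv (dualTensorHom k Y A (χ'.ofConv ⊗ₜ[k] a'))) y
      rw [LinearMap.convMul_apply, LinearMap.convMul_apply]
      generalize Coalgebra.comul (R := k) y = t
      induction t using TensorProduct.induction_on with
      | zero => simp
      | add s t hs ht => simp only [map_add, add_smul, hs, ht]
      | tmul y y' => simp [mul_smul, smul_comm (χ'.ofConv y')])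
    (by
      ext y
      exact (Algebra.algebraMap_eq_smul_one _).symm)

lemma dualTensorConv_one : dualTensorConv k Y A 1 = 1 := by
  ext y
  exact (Algebra.algebraMap_eq_smul_one _).symm

lemma dualTensorConv_bijective [FiniteDimensional k Y] :
    Function.Bijective (dualTensorConv k Y A) := by
  have h : Function.Bijective
      (LinearMap.rTensor A (WithConv.linearEquiv k (Y →ₗ[k] k)).toLinearMap) :=
    ((WithConv.linearEquiv k (Y →ₗ[k] k)).rTensor A).bijective
  exact (WithConv.linearEquiv k (Y →ₗ[k] A)).symm.bijective.comp
    (dualTensorHom_bijective.comp h)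

lemma dualTensorConv_map (π : Y →ₗc[k] P) (Φ : WithConv (P →ₗ[k] k) ⊗[k] A) :
    dualTensorConv k Y A (Algebra.TensorProduct.map (convPrecomp k π) (AlgHom.id k A) Φ) =
      convPrecomp A π (dualTensorConv k P A Φ) := by
  induction Φ using TensorProduct.induction_on with
  | zero => simp
  | add s t hs ht => simp only [map_add, hs, ht]
  | tmul χ a => rfl

omit [Coalgebra k Y] in
lemma finiteDimensional_withConv_dual [FiniteDimensional k Y] :
    FiniteDimensional k (WithConv (Y →ₗ[k] k)) :=
  (WithConv.linearEquiv k (Y →ₗ[k] k)).symm.finiteDimensional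

lemma convPrecomp_injective (π : Y →ₗc[k] P) (hπ : Function.Surjective π) :
    Function.Injective (convPrecomp A π) := fun u v h => by
  ext p
  obtain ⟨y, rfl⟩ := hπ p
  exact congrArg (fun w : WithConv (Y →ₗ[k] A) => w y) h

/-- Right convolution invertibility descends along a surjection onto a cocommutative coalgebra. -/
lemma exists_right_inv_of_surjective [FiniteDimensional k Y] [Coalgebra.IsCocomm k P]
    (π : Y →ₗc[k] P) (hπ : Function.Surjective π) (u : WithConv (P →ₗ[k] A))
    (v : WithConv (Y →ₗ[k] A)) (h : convPrecomp A π u * v = 1) : ∃ w, u * w = 1 := by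
  have : FiniteDimensional k P := Module.Finite.of_surjective (π : Y →ₗ[k] P) hπ
  have := finiteDimensional_withConv_dual (k := k) (Y := Y)
  have := finiteDimensional_withConv_dual (k := k) (Y := P)
  obtain ⟨Φ, rfl⟩ := dualTensorConv_bijective.surjective u
  obtain ⟨Ψ, rfl⟩ := dualTensorConv_bijective.surjective v
  rw [← dualTensorConv_map, ← map_mul] at h
  -- The dual of the cocommutative P is commutative, and surjectivity of π embeds it in the dual of
  -- Y.
  obtain ⟨y, hy⟩ := exists_right_inv_of_injective (convPrecomp k π)
    (convPrecomp_injective π hπ) Φ Ψ (dualTensorConv_bijective.injective (h.trans dualTensorConv_one.symm))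
  exact ⟨dualTensorConv k P A y, by rw [← map_mul, hy, dualTensorConv_one]⟩

end DualTensor

section SubcoalgebraCocomm

variable {k Y : Type*} [Field k] [AddCommGroup Y] [Module k Y] [Coalgebra k Y]

lemma IsSubcoalgebra.isCocomm {W : Submodule k Y} (hW : IsSubcoalgebra k W)
    (h : ∀ x ∈ W, TensorProduct.comm k Y Y (Coalgebra.comul (R := k) x) = Coalgebra.comul x) :
    letI := hW.coalgebra
    Coalgebra.IsCocomm k W := by
  let _ := hW.coalgebra
  refine ⟨LinearMap.ext fun x => mapIncl_injective W ?_⟩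
  change TensorProduct.map W.subtype W.subtype (TensorProduct.comm k W W (hW.comul x)) =
    TensorProduct.map W.subtype W.subtype (hW.comul x)
  rw [TensorProduct.map_comm, hW.mapIncl_comul, h x x.2]

end SubcoalgebraCocomm

section RightInverseOnImage

open WithConv

variable {k Y A : Type*} [Field k] [AddCommGroup Y] [Module k Y] [Coalgebra k Y]
  [Ring A] [Bialgebra k A]

/-- If a coalgebra map `φ` with cocommutative image is convolution invertible, then the identity is
right convolution invertible on the image of `φ`. -/
lemma exists_right_inv_on_image [FiniteDimensional k Y] (φ : Y →ₗc[k] A)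
    (hφ : ∀ y, TensorProduct.comm k A A (Coalgebra.comul (R := k) (φ y)) = Coalgebra.comul (φ y))
    (v : WithConv (Y →ₗ[k] A)) (h : toConv (φ : Y →ₗ[k] A) * v = 1) :
    ∃ τ : WithConv (A →ₗ[k] A), ∀ y, (toConv (LinearMap.id : A →ₗ[k] A) * τ) (φ y) =
      (1 : WithConv (A →ₗ[k] A)) (φ y) := by
  let W : Submodule k A := (⊤ : Submodule k Y).map (φ : Y →ₗ[k] A)
  have hW : IsSubcoalgebra k W := by
    have : IsSubcoalgebra k (⊤ : Submodule k Y) := by simp [isSubcoalgebra_iff]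
    exact this.map φ
  let _ := hW.coalgebra
  have hmem : ∀ y, φ y ∈ W := fun y => ⟨y, trivial, rfl⟩
  have : Coalgebra.IsCocomm k W := hW.isCocomm (by
    rintro _ ⟨y, -, rfl⟩
    exact hφ y)
  let π : Y →ₗc[k] W :=
    { (φ : Y →ₗ[k] A).codRestrict W hmem with
      counit_comp := LinearMap.ext fun y => CoalgHomClass.counit_comp_apply φ y
      map_comp_comul := LinearMap.ext fun y => by
        apply mapIncl_injective W
        refine Eq.trans ?_ (hW.mapIncl_comul ⟨φ y, hmem y⟩).symm
        refine Eq.trans ?_ (CoalgHomClass.map_comp_comul_apply φ y)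
        change TensorProduct.map W.subtype W.subtype (TensorProduct.map _ _ (Coalgebra.comul y)) = _
        rw [← LinearMap.comp_apply, ← TensorProduct.map_comp]
        rfl }
  have hπ : Function.Surjective π := by
    rintro ⟨_, y, -, rfl⟩
    exact ⟨y, rfl⟩
  obtain ⟨w, hw⟩ := exists_right_inv_of_surjective π hπ
    (convPrecomp A hW.incl (toConv LinearMap.id)) v h
  -- Any linear extension to A will do: W is a subcoalgebra, so convolution on W sees only values on
  -- W.
  obtain ⟨τ, hτ⟩ := LinearMap.exists_extend w.ofConv
  have hw' : w = convPrecomp A hW.incl (toConv τ) := ofConv_injective hτ.symm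
  rw [hw', ← map_mul, ← map_one (convPrecomp A hW.incl)] at hw
  exact ⟨toConv τ, fun y => congrArg (fun u : WithConv (W →ₗ[k] A) => u ⟨φ y, hmem y⟩) hw⟩

end RightInverseOnImage

/-! ### Nilpotency of maps vanishing on the coradical -/

section Nilpotent

open WithConv

variable {k D E A : Type*} [Field k] [AddCommGroup D] [Module k D] [Coalgebra k D]
  [AddCommGroup E] [Module k E] [Coalgebra k E] [Ring A] [Algebra k A]

/-- The map `d ⊗ e ↦ χ(d) g(e)`. -/
noncomputable def externalProduct (χ : WithConv (D →ₗ[k] k)) (g : WithConv (E →ₗ[k] A)) :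
    WithConv (D ⊗[k] E →ₗ[k] A) :=
  toConv ((TensorProduct.lid k A).toLinearMap ∘ₗ TensorProduct.map χ.ofConv g.ofConv)

omit [Coalgebra k D] [Coalgebra k E] in
lemma externalProduct_tmul (χ : WithConv (D →ₗ[k] k)) (g : WithConv (E →ₗ[k] A)) (d : D) (e : E) :
    externalProduct χ g (d ⊗ₜ e) = χ d • g e := rfl

lemma externalProduct_mul (χ χ' : WithConv (D →ₗ[k] k)) (g g' : WithConv (E →ₗ[k] A)) :
    externalProduct χ g * externalProduct χ' g' = externalProduct (χ * χ') (g * g') := by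
  ext d e
  change (externalProduct χ g * externalProduct χ' g') (d ⊗ₜ[k] e) = (χ * χ') d • (g * g') e
  rw [LinearMap.convMul_apply, LinearMap.convMul_apply, LinearMap.convMul_apply,
    TensorProduct.comul_tmul]
  generalize Coalgebra.comul (R := k) d = s
  induction s using TensorProduct.induction_on with
  | zero => simp
  | add s t hs ht => simp only [map_add, TensorProduct.add_tmul, hs, ht, add_smul]
  | tmul d d' =>
    generalize Coalgebra.comul (R := k) e = t
    induction t using TensorProduct.induction_on with
    | zero => simp
    | add s t hs ht => simp only [map_add, TensorProduct.tmul_add, hs, ht, smul_add]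
    | tmul e e' => simp [externalProduct_tmul, mul_smul, smul_comm (χ'.ofConv d')]

variable (E A) in
/-- The span of the maps `d ⊗ e ↦ χ(d) g(e)` with `χ` in a given ideal. -/
noncomputable def externalSpan (I : Ideal (WithConv (D →ₗ[k] k))) :
    Submodule k (WithConv (D ⊗[k] E →ₗ[k] A)) :=
  Submodule.span k {u | ∃ χ ∈ I, ∃ g, u = externalProduct χ g}

lemma mul_mem_externalSpan {I J : Ideal (WithConv (D →ₗ[k] k))}
    {u v : WithConv (D ⊗[k] E →ₗ[k] A)} (hu : u ∈ externalSpan E A I)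
    (hv : v ∈ externalSpan E A J) : u * v ∈ externalSpan E A (I * J) := by
  have : externalSpan E A I * externalSpan E A J ≤ externalSpan E A (I * J) := by
    rw [externalSpan, externalSpan, Submodule.span_mul_span]
    refine Submodule.span_mono ?_
    rintro _ ⟨_, ⟨χ, hχ, g, rfl⟩, _, ⟨χ', hχ', g', rfl⟩, rfl⟩
    exact ⟨χ * χ', Ideal.mul_mem_mul hχ hχ', g * g', externalProduct_mul χ χ' g g'⟩
  exact this (Submodule.mul_mem_mul hu hv)

lemma pow_mem_externalSpan {I : Ideal (WithConv (D →ₗ[k] k))} {u : WithConv (D ⊗[k] E →ₗ[k] A)}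
    (hu : u ∈ externalSpan E A I) (n : ℕ) : u ^ (n + 1) ∈ externalSpan E A (I ^ (n + 1)) := by
  induction n with
  | zero => rwa [pow_one, Submodule.pow_one]
  | succ n ih =>
    rw [pow_succ, Submodule.pow_succ]
    exact mul_mem_externalSpan ih hu

omit [Coalgebra k E] in
lemma externalSpan_bot : externalSpan E A (⊥ : Ideal (WithConv (D →ₗ[k] k))) = ⊥ := by
  refine Submodule.span_eq_bot.2 ?_
  rintro _ ⟨χ, hχ, g, rfl⟩
  rw [Ideal.mem_bot.1 hχ]
  ext d e
  change (0 : k) • g e = 0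
  rw [zero_smul]

-- Projecting W away and expanding the first variable in a basis of D writes u as a finite sum whose
-- functionals kill W.
omit [Coalgebra k E] in
lemma mem_externalSpan_perp [FiniteDimensional k D] {W : Submodule k D} (hW : IsSubcoalgebra k W)
    (u : WithConv (D ⊗[k] E →ₗ[k] A)) (hu : ∀ d ∈ W, ∀ e, u (d ⊗ₜ e) = 0) :
    u ∈ externalSpan E A hW.perp := by
  obtain ⟨p, hp⟩ := LinearMap.exists_leftInverse_of_injective W.subtype W.ker_subtype
  let q : D →ₗ[k] D := LinearMap.id - W.subtype ∘ₗ p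
  have hqW : ∀ d ∈ W, q d = 0 := fun d hd => by
    have h1 : p d = ⟨d, hd⟩ := LinearMap.congr_fun hp ⟨d, hd⟩
    simp [q, h1]
  let b := Module.finBasis k D
  have : u = ∑ i, externalProduct (toConv (b.coord i ∘ₗ q))
      (toConv (u.ofConv ∘ₗ TensorProduct.mk k D E (b i))) := by
    ext d e
    change u (d ⊗ₜ[k] e) = _
    have h1 : u (d ⊗ₜ[k] e) = u (q d ⊗ₜ[k] e) := by
      rw [← sub_eq_zero, ← map_sub, ← TensorProduct.sub_tmul]
      exact hu _ (by simp [q]) e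
    have h2 : q d = ∑ i, b.coord i (q d) • b i := (b.sum_repr (q d)).symm
    rw [h1]
    conv_lhs => rw [h2, TensorProduct.sum_tmul, map_sum]
    simp only [← TensorProduct.smul_tmul', map_smul, WithConv.ofConv_sum,
      TensorProduct.AlgebraTensorModule.curry_apply, TensorProduct.curry_apply,
      LinearMap.coe_restrictScalars, LinearMap.sum_apply]
    rfl
  rw [this]
  refine sum_mem fun i _ => Submodule.subset_span ⟨_, fun d hd => ?_, _, rfl⟩
  change b.coord i (q d) = 0
  rw [hqW d hd, map_zero]

/-- A map on `D ⊗ E` vanishing on `D₀ ⊗ E`, with `D₀` the coradical of `D`, is nilpotent for the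
convolution product. -/
lemma isNilpotent_of_coradical [FiniteDimensional k D] (u : WithConv (D ⊗[k] E →ₗ[k] A))
    (hu : ∀ d ∈ coradical k D, ∀ e, u (d ⊗ₜ e) = 0) : IsNilpotent u := by
  obtain ⟨n, hn⟩ := isNilpotent_perp_coradical (k := k) (D := D)
  have h := pow_mem_externalSpan (mem_externalSpan_perp isSubcoalgebra_coradical u hu) n
  rw [Submodule.pow_succ, hn, zero_mul,
    Ideal.zero_eq_bot, externalSpan_bot] at h
  exact ⟨n + 1, (Submodule.mem_bot k).1 h⟩

end Nilpotent

/-! ### The kernel of f is killed by f ∘ (S ⊗ id) -/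

section Main

open WithConv

variable {k B C A D E : Type*} [Field k] [Ring B] [HopfAlgebra k B]
    [AddCommGroup C] [Module k C] [Coalgebra k C] [Ring A] [Bialgebra k A]
    [AddCommGroup D] [Module k D] [Coalgebra k D] [AddCommGroup E] [Module k E] [Coalgebra k E]

/-- The antipode is a coalgebra map on D, so f and its inverse are both coalgebra maps on D ⊗ E.
Having τ defined on A allows it to be pulled back later to a larger coalgebra. -/
lemma exists_right_inv_on_cocomm {f : B ⊗[k] C →ₗc[k] A} (hf : IsMeasuring (f : B ⊗[k] C →ₗ[k] A))
    [FiniteDimensional k D] [FiniteDimensional k E] [Coalgebra.IsCocomm k D]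
    (j : D →ₗc[k] B) (i : E →ₗc[k] C) :
    ∃ τ : WithConv (A →ₗ[k] A), ∀ d e, (toConv (LinearMap.id : A →ₗ[k] A) * τ) (f (j d ⊗ₜ i e)) =
      (1 : WithConv (A →ₗ[k] A)) (f (j d ⊗ₜ i e)) := by
  let φ : D ⊗[k] E →ₗc[k] A := f.comp (Coalgebra.TensorProduct.map j i)
  let ψ : D ⊗[k] E →ₗc[k] A := f.comp (Coalgebra.TensorProduct.map (antipodeComp j) i)
  have hφ : toConv (φ : D ⊗[k] E →ₗ[k] A) =
      convPrecomp A (Coalgebra.TensorProduct.map j i) (toConv (f : B ⊗[k] C →ₗ[k] A)) := rfl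
  have hψ : toConv (ψ : D ⊗[k] E →ₗ[k] A) = convPrecomp A (Coalgebra.TensorProduct.map j i)
      (toConv ((f : B ⊗[k] C →ₗ[k] A) ∘ₗ LinearMap.rTensor C (HopfAlgebra.antipode k))) := by
    ext d e
    rfl
  have h1 : toConv (φ : D ⊗[k] E →ₗ[k] A) * toConv (ψ : D ⊗[k] E →ₗ[k] A) = 1 := by
    rw [hφ, hψ, ← map_mul, hf.conv_mul_antipode, map_one]
  have h2 : toConv (ψ : D ⊗[k] E →ₗ[k] A) * toConv (φ : D ⊗[k] E →ₗ[k] A) = 1 := by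
    rw [hφ, hψ, ← map_mul, hf.antipode_conv_mul, map_one]
  obtain ⟨τ, hτ⟩ := exists_right_inv_on_image φ (comm_comul_of_conv_inverse φ ψ h1 h2) _ h1
  exact ⟨τ, fun d e => hτ (d ⊗ₜ e)⟩

/-- The error 1 - u * τ becomes nilpotent only after pullback along F, but the geometric series
correcting τ is formed on A, so that σ lives there. -/
lemma exists_right_inv_of_coradical [FiniteDimensional k D] (F : D ⊗[k] E →ₗc[k] A)
    (u τ : WithConv (A →ₗ[k] A)) (hτ : ∀ d ∈ coradical k D, ∀ e, (u * τ) (F (d ⊗ₜ e)) =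
      (1 : WithConv (A →ₗ[k] A)) (F (d ⊗ₜ e))) :
    ∃ σ : WithConv (A →ₗ[k] A), convPrecomp A F (u * σ) = 1 := by
  obtain ⟨m, hm⟩ : IsNilpotent (convPrecomp A F (1 - u * τ)) :=
    isNilpotent_of_coradical _ fun d hd e => sub_eq_zero.2 (hτ d hd e).symm
  refine ⟨τ * ∑ l ∈ Finset.range m, (1 - u * τ) ^ l, ?_⟩
  have h : u * (τ * ∑ l ∈ Finset.range m, (1 - u * τ) ^ l) = 1 - (1 - u * τ) ^ m := by
    rw [← mul_neg_geom_sum, sub_sub_cancel, mul_assoc]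
  rw [h, map_sub, map_pow, map_one, hm, sub_zero]

lemma exists_right_inv_on_coradical {f : B ⊗[k] C →ₗc[k] A}
    (hf : IsMeasuring (f : B ⊗[k] C →ₗ[k] A))
    [FiniteDimensional k D] [FiniteDimensional k E] (hD : HasCocommCoradical k D)
    (j : D →ₗc[k] B) (i : E →ₗc[k] C) :
    ∃ τ : WithConv (A →ₗ[k] A), ∀ d ∈ coradical k D, ∀ e,
      (toConv (LinearMap.id : A →ₗ[k] A) * τ) (f (j d ⊗ₜ i e)) =
        (1 : WithConv (A →ₗ[k] A)) (f (j d ⊗ₜ i e)) := by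
  have h0 := isSubcoalgebra_coradical (k := k) (C := D)
  let _ := h0.coalgebra
  have : Coalgebra.IsCocomm k (coradical k D) := h0.isCocomm fun x hx => hD x hx
  obtain ⟨τ, hτ⟩ := exists_right_inv_on_cocomm hf (j.comp h0.incl) i
  exact ⟨τ, fun d hd e => hτ ⟨d, hd⟩ e⟩

/-- On D ⊗ E the left inverse f ∘ (S ⊗ id) equals the right inverse σ ∘ f, which vanishes wherever f
does. -/
lemma map_antipode_eq_zero_of_finite {f : B ⊗[k] C →ₗc[k] A}
    (hf : IsMeasuring (f : B ⊗[k] C →ₗ[k] A))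
    [FiniteDimensional k D] [FiniteDimensional k E] (hD : HasCocommCoradical k D)
    (j : D →ₗc[k] B) (i : E →ₗc[k] C) (y : D ⊗[k] E)
    (hy : f (Coalgebra.TensorProduct.map j i y) = 0) :
    f (LinearMap.rTensor C (HopfAlgebra.antipode k) (Coalgebra.TensorProduct.map j i y)) = 0 := by
  obtain ⟨τ, hτ⟩ := exists_right_inv_on_coradical hf hD j i
  obtain ⟨σ, hσ⟩ := exists_right_inv_of_coradical
    (f.comp (Coalgebra.TensorProduct.map j i)) (toConv LinearMap.id) τ hτ
  have hinv := congrArg (convPrecomp A (Coalgebra.TensorProduct.map j i)) hf.antipode_conv_mul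
  rw [map_mul, map_one] at hinv
  rw [map_mul] at hσ
  have heq := left_inv_eq_right_inv hinv hσ
  have := congrArg (fun u : WithConv (D ⊗[k] E →ₗ[k] A) => u y) heq
  refine Eq.trans this ?_
  exact (congrArg σ.ofConv hy).trans (map_zero _)

lemma exists_finite_mem_range_map (x : B ⊗[k] C) :
    ∃ (W : Submodule k B) (V : Submodule k C), IsSubcoalgebra k W ∧ IsSubcoalgebra k V ∧
      FiniteDimensional k W ∧ FiniteDimensional k V ∧
      x ∈ LinearMap.range (TensorProduct.map W.subtype V.subtype) := by
  induction x using TensorProduct.induction_on with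
  | zero => exact ⟨⊥, ⊥, by simp [isSubcoalgebra_iff], by simp [isSubcoalgebra_iff],
      inferInstance, inferInstance, zero_mem _⟩
  | tmul b c =>
    obtain ⟨W, hW, hW', hb⟩ := exists_finite_isSubcoalgebra_mem (k := k) b
    obtain ⟨V, hV, hV', hc⟩ := exists_finite_isSubcoalgebra_mem (k := k) c
    exact ⟨W, V, hW, hV, hW', hV', ⟨⟨b, hb⟩ ⊗ₜ ⟨c, hc⟩, rfl⟩⟩
  | add x y hx hy =>
    obtain ⟨W, V, hW, hV, hW', hV', hx⟩ := hx
    obtain ⟨W₁, V₁, hW₁, hV₁, hW₁', hV₁', hy⟩ := hy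
    have hmono : ∀ {W W' : Submodule k B} {V V' : Submodule k C}, W ≤ W' → V ≤ V' →
        LinearMap.range (TensorProduct.map W.subtype V.subtype) ≤
          LinearMap.range (TensorProduct.map W'.subtype V'.subtype) := by
      rintro W W' V V' hW hV _ ⟨t, rfl⟩
      refine ⟨TensorProduct.map (Submodule.inclusion hW) (Submodule.inclusion hV) t, ?_⟩
      rw [← LinearMap.comp_apply, ← TensorProduct.map_comp]
      rfl
    exact ⟨W ⊔ W₁, V ⊔ V₁, isSubcoalgebra_sup hW hW₁, isSubcoalgebra_sup hV hV₁, inferInstance,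
      inferInstance, add_mem (hmono le_sup_left le_sup_left hx)
        (hmono le_sup_right le_sup_right hy)⟩

lemma map_antipode_eq_zero {f : B ⊗[k] C →ₗc[k] A} (hf : IsMeasuring (f : B ⊗[k] C →ₗ[k] A))
    (hB : HasCocommCoradical k B) (x : B ⊗[k] C) (hx : f x = 0) :
    f (LinearMap.rTensor C (HopfAlgebra.antipode k) x) = 0 := by
  obtain ⟨W, V, hW, hV, hW', hV', y, rfl⟩ := exists_finite_mem_range_map x
  let _ := hW.coalgebra
  let _ := hV.coalgebra
  have hWc : HasCocommCoradical k W := hB.of_injective hW.incl W.injective_subtype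
  exact map_antipode_eq_zero_of_finite hf hWc hW.incl hV.incl y hx

end Main

end BialgCovering

open WithConv in
theorem mainTheorem2 {k B C A : Type*} [Field k] [Ring B] [HopfAlgebra k B]
    [AddCommGroup C] [Module k C] [Coalgebra k C] [Ring A] [bialgA : Bialgebra k A]
    (f : B ⊗[k] C →ₗc[k] A) (hf : BialgCovering.IsCovering f)
    (hB : BialgCovering.HasCocommCoradical k B) :
    ∃ H : HopfAlgebra k A, H.toBialgebra = bialgA := by
  obtain ⟨r, hr⟩ := LinearMap.exists_rightInverse_of_surjective (f : B ⊗[k] C →ₗ[k] A)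
    (LinearMap.range_eq_top.2 hf.surjective)
  let g := (f : B ⊗[k] C →ₗ[k] A) ∘ₗ LinearMap.rTensor C (HopfAlgebra.antipode k)
  -- Since x and r (f x) differ by an element of ker f, which g kills, the choice of section is
  -- immaterial.
  have hS : BialgCovering.convPrecomp A f (toConv (g ∘ₗ r)) = toConv g := by
    apply ofConv_injective
    refine LinearMap.ext fun x => ?_
    change g (r (f x)) = g x
    rw [← sub_eq_zero, ← map_sub]
    refine BialgCovering.map_antipode_eq_zero hf.isMeasuring hB _ ?_
    rw [map_sub, sub_eq_zero]
    exact LinearMap.congr_fun hr (f x)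
  -- The antipode identities on A may be checked after pulling back along the surjection f.
  have hinj := BialgCovering.convPrecomp_injective (A := A) f hf.surjective
  have hid : BialgCovering.convPrecomp A f (toConv LinearMap.id) =
      toConv (f : B ⊗[k] C →ₗ[k] A) := rfl
  have h1 : toConv (g ∘ₗ r) * toConv LinearMap.id = 1 := hinj (by
    rw [map_mul, map_one, hS, hid, hf.isMeasuring.antipode_conv_mul])
  have h2 : toConv LinearMap.id * toConv (g ∘ₗ r) = 1 := hinj (by
    rw [map_mul, map_one, hS, hid, hf.isMeasuring.conv_mul_antipode])
  exact ⟨{ bialgA with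
    antipode := g ∘ₗ r
    mul_antipode_rTensor_comul := congrArg ofConv h1
    mul_antipode_lTensor_comul := congrArg ofConv h2 }, rfl⟩
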